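/- Let $\mathcal C$ be a symmetric monoidal category with unit $I$. Write $c_1\otimes\cdots\otimes c_k$ for the left-bracketed product $((c_1\otimes c_2)\otimes\cdots)\otimes c_k$ (it is $I$ for $k=0$ and $c_1$ for $k=1$), and $c^{\otimes m}$ for its value on $m$ copies of $c$. Let $\sigma$ denote the canonical symmetry isomorphisms $c_1^{\otimes m}\otimes\cdots\otimes c_k^{\otimes m}\cong(c_1\otimes\cdots\otimes c_k)^{\otimes m}$, in particular $c^{\otimes m}\otimes d^{\otimes m}\cong(c\otimes d)^{\otimes m}$ and $I\cong I^{\otimes m}$. A *prop* $\mathbb P$ is a symmetric strict monoidal category whose monoid of objects is $(\mathbb N,0,+)$. A *supply* $s$ of $\mathbb P$ in $\mathcal C$ consists of a strong symmetric monoidal functor $s_c\colon\mathbb P\to\mathcal C$ for each object $c$ of $\mathcal C$ such that (i) $s_c(m)=c^{\otimes m}$; (ii) the strongator $c^{\otimes m}\otimes c^{\otimes n}\to c^{\otimes(m+n)}$ is the coherence isomorphism; (iii) for all $c,d$ and $\mu\colon m\to n$ in $\mathbb P$, in diagrammatic order, $(s_c(\mu)\otimes s_d(\mu))\,;\,\sigma=\sigma\,;\,s_{c\otimes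 d}(\mu)$ and $\sigma=\sigma\,;\,s_I(\mu)$ (as maps $I\to I^{\otimes n}$). Given supplies $s$ of $\mathbb P$ in $\mathcal C$ and $t$ of $\mathbb P$ in $\mathcal D$, a strong symmetric monoidal functor $F\colon\mathcal C\to\mathcal D$ *preserves the supply* if for each object $c$ of $\mathcal C$ the strongators $F(c)^{\otimes m}\cong F(c^{\otimes m})$ of $F$ form a natural isomorphism from $t_{F(c)}$ to $F\circ s_c$ of functors $\mathbb P\to\mathcal D$. The *strictification* $\overline{\mathcal C}$ of $\mathcal C$ has as objects the finite lists of objects of $\mathcal C$, as morphisms $[c_1,\dots,c_k]\to[d_1,\dots,d_l]$ the morphisms $c_1\otimes\cdots\otimes c_k\to d_1\otimes\cdots\otimes d_l$ of $\mathcal C$, concatenation as strict monoidal product on objects, and the product of morphisms and the braiding of $\mathcal C$ transported along the coherence isomorphisms. The functor $\bigotimes\colon\overline{\mathcal C}\to\mathcal C$, $[c_1,\dots,c_k]\mapsto c_1\otimes\cdots\otimes c_k$, is a strong symmetric monoidal equivalence. Let $s$ be a supply of $\mathbb P$ in $\mathcal C$. Then there is a supply $\overline s$ of $\mathbb P$ in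 $\overline{\mathcal C}$, the *induced supply*, given for $L=[c_1,\dots,c_k]$ and $\mu\colon m\to n$ by $$\overline s_L(\mu)=\sigma^{-1}\,;\,\bigl(s_{[c_1]}(\mu)\otimes\cdots\otimes s_{[c_k]}(\mu)\bigr)\,;\,\sigma\ \colon\ L^{\otimes m}\to L^{\otimes n},$$ where the products and the $\sigma$'s are those of $\overline{\mathcal C}$ and $s_{[c]}(\mu)\colon[c]^{\otimes m}\to[c]^{\otimes n}$ is the morphism of $\overline{\mathcal C}$ that $\bigotimes$ sends to $s_c(\mu)\colon c^{\otimes m}\to c^{\otimes n}$. Moreover, the equivalence $\bigotimes\colon\overline{\mathcal C}\to\mathcal C$ preserves the supply, with respect to $\overline s$ in $\overline{\mathcal C}$ and $s$ in $\mathcal C$. -/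

import Mathlib

open CategoryTheory MonoidalCategory

universe v v₁ v₂ u u₁ u₂

/-- Finite lists `[x₁, …, xₖ]`, built up by adding entries on the right. -/
inductive Word (ι : Type u) : Type u
  | nil : Word ι
  | snoc : Word ι → ι → Word ι

namespace Word

/-- The one-entry list `[x]`. -/
def single {ι : Type u} (x : ι) : Word ι := snoc nil x

/-- Concatenation of lists. -/
def append {ι : Type u} (w : Word ι) : Word ι → Word ι
  | nil => w
  | snoc w' x => snoc (append w w') x

theorem nil_append {ι : Type u} : ∀ w : Word ι, append nil w = w
  | nil => rfl
  | snoc w x => congrArg (fun z => snoc z x) (nil_append w)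

theorem append_assoc {ι : Type u} (w₁ w₂ : Word ι) :
    ∀ w₃ : Word ι, append (append w₁ w₂) w₃ = append w₁ (append w₂ w₃)
  | nil => rfl
  | snoc w x => congrArg (fun z => snoc z x) (append_assoc w₁ w₂ w)

/-- Apply a function to every entry. -/
def map {ι : Type u₁} {κ : Type u₂} (f : ι → κ) : Word ι → Word κ
  | nil => nil
  | snoc w x => snoc (map f w) (f x)

/-- The list `[x, …, x]` with `n` entries. -/
def replicate {ι : Type u} (x : ι) : ℕ → Word ι
  | 0 => nil
  | n + 1 => snoc (replicate x n) x

end Word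

/-! ### Iterated monoidal products and canonical isomorphisms -/

section Monoidal

variable {C : Type u₁} [Category.{v₁} C] [MonoidalCategory C]

/-- The left-bracketed product `((c₁ ⊗ c₂) ⊗ ⋯) ⊗ cₖ`; it is `𝟙_ C` for the empty list, and `c`
for the one-entry list `[c]`. -/
def Word.tensor : Word C → C
  | .nil => 𝟙_ C
  | .snoc .nil c => c
  | .snoc (.snoc w d) c => Word.tensor (.snoc w d) ⊗ c

/-- The canonical isomorphism `(c₁ ⊗ ⋯ ⊗ cₖ) ⊗ c ≅ c₁ ⊗ ⋯ ⊗ cₖ ⊗ c`: an identity if `k > 0`, and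
the left unitor if `k = 0`. -/
def Word.snocIso : ∀ (w : Word C) (c : C), w.tensor ⊗ c ≅ (Word.snoc w c).tensor
  | .nil, c => λ_ c
  | .snoc w d, c => Iso.refl ((Word.snoc w d).tensor ⊗ c)

/-- The canonical isomorphism
`(c₁ ⊗ ⋯ ⊗ cₖ) ⊗ (d₁ ⊗ ⋯ ⊗ dₗ) ≅ c₁ ⊗ ⋯ ⊗ cₖ ⊗ d₁ ⊗ ⋯ ⊗ dₗ`, composed of associators and
unitors. -/
def Word.appendIso (w : Word C) : ∀ w' : Word C, w.tensor ⊗ w'.tensor ≅ (w.append w').tensor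
  | .nil => ρ_ w.tensor
  | .snoc w' c =>
      whiskerLeftIso w.tensor (Word.snocIso w' c).symm ≪≫
        (α_ w.tensor w'.tensor c).symm ≪≫
        whiskerRightIso (Word.appendIso w w') c ≪≫ Word.snocIso (w.append w') c

/-- The product `f_{i₁} ⊗ ⋯ ⊗ f_{iₖ}` of the morphisms `fᵢ : X i ⟶ Y i`, along a list
`[i₁, …, iₖ]`. -/
def Word.tensorMap {ι : Type u} {X Y : ι → C} (f : ∀ i, X i ⟶ Y i) :
    ∀ w : Word ι, (w.map X).tensor ⟶ (w.map Y).tensor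
  | .nil => 𝟙 (𝟙_ C)
  | .snoc w i =>
      (Word.snocIso (w.map X) (X i)).inv ≫ (Word.tensorMap f w ⊗ₘ f i) ≫
        (Word.snocIso (w.map Y) (Y i)).hom

/-- The tensor power `c^{⊗n} = ((c ⊗ c) ⊗ ⋯) ⊗ c`. -/
def tpow (c : C) (n : ℕ) : C := (Word.replicate c n).tensor

/-- The canonical isomorphism `c^{⊗n} ⊗ c ≅ c^{⊗(n+1)}`. -/
def tpowSucc (c : C) (n : ℕ) : tpow c n ⊗ c ≅ tpow c (n + 1) :=
  Word.snocIso (Word.replicate c n) c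

/-- The tensor power `f^{⊗n} : c^{⊗n} ≅ d^{⊗n}` of an isomorphism. -/
def tpowMapIso {c d : C} (f : c ≅ d) : ∀ n : ℕ, tpow c n ≅ tpow d n
  | 0 => Iso.refl (𝟙_ C)
  | n + 1 => (tpowSucc c n).symm ≪≫ (tpowMapIso f n ⊗ᵢ f) ≪≫ tpowSucc d n

/-- The coherence isomorphism `c^{⊗m} ⊗ c^{⊗n} ≅ c^{⊗(m+n)}`, composed of associators and
unitors. -/
def tpowAdd (c : C) (m : ℕ) : ∀ n : ℕ, tpow c m ⊗ tpow c n ≅ tpow c (m + n)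
  | 0 => ρ_ (tpow c m)
  | n + 1 =>
      whiskerLeftIso (tpow c m) (tpowSucc c n).symm ≪≫
        (α_ (tpow c m) (tpow c n) c).symm ≪≫
        whiskerRightIso (tpowAdd c m n) c ≪≫ tpowSucc c (m + n)

/-- The canonical isomorphism `σ : I ≅ I^{⊗n}`. -/
def sigmaUnit : ∀ n : ℕ, 𝟙_ C ≅ tpow (𝟙_ C) n
  | 0 => Iso.refl (𝟙_ C)
  | n + 1 =>
      (λ_ (𝟙_ C)).symm ≪≫ whiskerRightIso (sigmaUnit n) (𝟙_ C) ≪≫ tpowSucc (𝟙_ C) n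

end Monoidal

section Symmetric

variable {C : Type u₁} [Category.{v₁} C] [MonoidalCategory C] [SymmetricCategory C]

/-- The middle-four interchange `(a ⊗ b) ⊗ (c ⊗ d) ≅ (a ⊗ c) ⊗ (b ⊗ d)`. -/
def interchangeIso (a b c d : C) : (a ⊗ b) ⊗ (c ⊗ d) ≅ (a ⊗ c) ⊗ (b ⊗ d) where
  hom := tensorμ a b c d
  inv := tensorδ a b c d
  hom_inv_id := tensorμ_tensorδ a b c d
  inv_hom_id := tensorδ_tensorμ a b c d

/-- The symmetry isomorphism `σ : c^{⊗n} ⊗ d^{⊗n} ≅ (c ⊗ d)^{⊗n}`. -/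
def sigmaPair (c d : C) : ∀ n : ℕ, tpow c n ⊗ tpow d n ≅ tpow (c ⊗ d) n
  | 0 => λ_ (𝟙_ C)
  | n + 1 =>
      ((tpowSucc c n).symm ⊗ᵢ (tpowSucc d n).symm) ≪≫
        interchangeIso (tpow c n) c (tpow d n) d ≪≫
        whiskerRightIso (sigmaPair c d n) (c ⊗ d) ≪≫ tpowSucc (c ⊗ d) n

/-- The symmetry isomorphism
`σ : X_{i₁}^{⊗n} ⊗ ⋯ ⊗ X_{iₖ}^{⊗n} ≅ (X_{i₁} ⊗ ⋯ ⊗ X_{iₖ})^{⊗n}`. -/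
def sigmaWord {ι : Type u} (X : ι → C) (n : ℕ) :
    ∀ w : Word ι, (w.map fun i => tpow (X i) n).tensor ≅ tpow (w.map X).tensor n
  | .nil => sigmaUnit n
  | .snoc w i =>
      (Word.snocIso (w.map fun i => tpow (X i) n) (tpow (X i) n)).symm ≪≫
        whiskerRightIso (sigmaWord X n w) (tpow (X i) n) ≪≫
        sigmaPair (w.map X).tensor (X i) n ≪≫
        tpowMapIso (Word.snocIso (w.map X) (X i)) n

end Symmetric

/-- The strongator `φ : F(c)^{⊗n} ≅ F(c^{⊗n})` of a strong monoidal functor, composed of the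
strongators `I ≅ F(I)` and `F(c) ⊗ F(c') ≅ F(c ⊗ c')`. -/
def tpowStrongator {C : Type u₁} [Category.{v₁} C] [MonoidalCategory C]
    {D : Type u₂} [Category.{v₂} D] [MonoidalCategory D] (F : C ⥤ D) [F.Monoidal] (c : C) :
    ∀ n : ℕ, tpow (F.obj c) n ≅ F.obj (tpow c n)
  | 0 => Functor.Monoidal.εIso F
  | n + 1 =>
      (tpowSucc (F.obj c) n).symm ≪≫ whiskerRightIso (tpowStrongator F c n) (F.obj c) ≪≫
        Functor.Monoidal.μIso F (tpow c n) c ≪≫ F.mapIso (tpowSucc c n)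

/-! ### Props -/

/-- A monoidal category is strict if its product is strictly associative and unital, and its
associators and unitors are identities. -/
class IsStrictMonoidal (C : Type u₁) [Category.{v₁} C] [MonoidalCategory C] : Prop where
  tensor_assoc : ∀ X Y Z : C, (X ⊗ Y) ⊗ Z = X ⊗ (Y ⊗ Z)
  unit_tensor : ∀ X : C, 𝟙_ C ⊗ X = X
  tensor_unit : ∀ X : C, X ⊗ 𝟙_ C = X
  associator_eq : ∀ X Y Z : C, (α_ X Y Z).hom = eqToHom (tensor_assoc X Y Z)
  leftUnitor_eq : ∀ X : C, (λ_ X).hom = eqToHom (unit_tensor X)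
  rightUnitor_eq : ∀ X : C, (ρ_ X).hom = eqToHom (tensor_unit X)

/-- A prop: a symmetric strict monoidal category whose monoid of objects is `(ℕ, 0, +)`. The
identification of the objects with the natural numbers is `size` (it is unique, as `ℕ` has no
nontrivial monoid automorphism). -/
class PROP (P : Type u) [Category.{v} P] [MonoidalCategory P] [SymmetricCategory P]
    extends IsStrictMonoidal P where
  size : P ≃ ℕ
  size_unit : size (𝟙_ P) = 0
  size_tensor : ∀ p q : P, size (p ⊗ q) = size p + size q

/-! ### Supply -/

/-- A supply of the prop `P` in the symmetric monoidal category `C`. -/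
structure Supply (P : Type u) [Category.{v} P] [MonoidalCategory P] [SymmetricCategory P] [PROP P]
    (C : Type u₁) [Category.{v₁} C] [MonoidalCategory C] [SymmetricCategory C] where
  /-- the functors `s_c : P ⥤ C` -/
  functor : C → P ⥤ C
  /-- each `s_c` is a strong symmetric monoidal functor -/
  braided : ∀ c, (functor c).Braided
  /-- `s_c(m) = c^{⊗m}` -/
  obj_eq : ∀ (c : C) (p : P), (functor c).obj p = tpow c (PROP.size p)
  /-- the strongator `c^{⊗m} ⊗ c^{⊗n} ⟶ c^{⊗(m+n)}` of `s_c` is the coherence isomorphism -/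
  strongator_eq : ∀ (c : C) (p q : P),
    Functor.LaxMonoidal.μ (functor c) p q =
      (eqToHom (obj_eq c p) ⊗ₘ eqToHom (obj_eq c q)) ≫
        (tpowAdd c (PROP.size p) (PROP.size q)).hom ≫
        eqToHom (by rw [obj_eq, PROP.size_tensor])
  /-- the square relating `s_c(μ) ⊗ s_d(μ)` to `s_{c ⊗ d}(μ)` through `σ` -/
  map_tensor : ∀ (c d : C) {p q : P} (μ : p ⟶ q),
    ((eqToHom (obj_eq c p).symm ≫ (functor c).map μ ≫ eqToHom (obj_eq c q)) ⊗ₘ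
        (eqToHom (obj_eq d p).symm ≫ (functor d).map μ ≫ eqToHom (obj_eq d q))) ≫
        (sigmaPair c d (PROP.size q)).hom =
      (sigmaPair c d (PROP.size p)).hom ≫
        (eqToHom (obj_eq (c ⊗ d) p).symm ≫ (functor (c ⊗ d)).map μ ≫ eqToHom (obj_eq (c ⊗ d) q))
  /-- the triangle relating `s_I(μ)` to the identity of `I` through `σ` -/
  map_unit : ∀ {p q : P} (μ : p ⟶ q),
    (sigmaUnit (PROP.size q)).hom =
      (sigmaUnit (PROP.size p)).hom ≫
        (eqToHom (obj_eq (𝟙_ C) p).symm ≫ (functor (𝟙_ C)).map μ ≫ eqToHom (obj_eq (𝟙_ C) q))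

/-- The morphism `s_c(μ) : c^{⊗m} ⟶ c^{⊗n}` supplied for `μ : m ⟶ n`. -/
def Supply.map {P : Type u} [Category.{v} P] [MonoidalCategory P] [SymmetricCategory P] [PROP P]
    {C : Type u₁} [Category.{v₁} C] [MonoidalCategory C] [SymmetricCategory C]
    (s : Supply P C) (c : C) {p q : P} (μ : p ⟶ q) :
    tpow c (PROP.size p) ⟶ tpow c (PROP.size q) :=
  eqToHom (s.obj_eq c p).symm ≫ (s.functor c).map μ ≫ eqToHom (s.obj_eq c q)

/-- A strong symmetric monoidal functor `F : C ⥤ D` preserves the supplies `s` in `C` and `t` in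
`D` if for each `c` its strongators `F(c)^{⊗m} ≅ F(c^{⊗m})` are the components of a natural
isomorphism `t_{F(c)} ≅ s_c ⋙ F` of functors `P ⥤ D`. -/
def PreservesSupply {P : Type u} [Category.{v} P] [MonoidalCategory P] [SymmetricCategory P]
    [PROP P] {C : Type u₁} [Category.{v₁} C] [MonoidalCategory C] [SymmetricCategory C]
    {D : Type u₂} [Category.{v₂} D] [MonoidalCategory D] [SymmetricCategory D]
    (F : C ⥤ D) [F.Braided] (s : Supply P C) (t : Supply P D) : Prop :=
  ∀ c : C, ∃ φ : t.functor (F.obj c) ≅ s.functor c ⋙ F, ∀ p : P,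
    φ.hom.app p =
      eqToHom (t.obj_eq (F.obj c) p) ≫ (tpowStrongator F c (PROP.size p)).hom ≫
        F.map (eqToHom (s.obj_eq c p).symm)

/-! ### Strictification -/

section Strictification

variable (C : Type u₁) [Category.{v₁} C] [MonoidalCategory C]

/-- Mac Lane's strictification of `C`: the objects are the finite lists of objects of `C`, and the
morphisms `[c₁, …, cₖ] ⟶ [d₁, …, dₗ]` are the morphisms `c₁ ⊗ ⋯ ⊗ cₖ ⟶ d₁ ⊗ ⋯ ⊗ dₗ` of `C`. -/
def Strictification : Type u₁ := InducedCategory C (Word.tensor (C := C))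

instance : Category.{v₁} (Strictification C) :=
  inferInstanceAs (Category (InducedCategory C (Word.tensor (C := C))))

/-- The functor `⨂` from the strictification to `C`, sending `[c₁, …, cₖ]` to `c₁ ⊗ ⋯ ⊗ cₖ`. -/
def bigTensor : Strictification C ⥤ C := inducedFunctor (Word.tensor (C := C))

instance : (bigTensor C).Full := InducedCategory.full _

instance : (bigTensor C).Faithful := InducedCategory.faithful _

instance : (bigTensor C).EssSurj where
  mem_essImage c := ⟨Word.single c, ⟨Iso.refl c⟩⟩

instance : (bigTensor C).IsEquivalence where

variable {C}

/-- The object of the strictification given by a list. -/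
def Strictification.of (w : Word C) : Strictification C := w

/-- The list underlying an object of the strictification. -/
def Strictification.word (X : Strictification C) : Word C := X

/-- The morphism of the strictification given by a morphism of `C`. -/
def Strictification.homMk {X Y : Strictification C} (f : X.word.tensor ⟶ Y.word.tensor) : X ⟶ Y :=
  InducedCategory.homMk f

/-- The canonical isomorphism `⨂ X ⊗ ⨂ Y ≅ ⨂ (X · Y)`, where `X · Y` is the concatenation. -/
def bigTensorμIso (X Y : Strictification C) :
    (bigTensor C).obj X ⊗ (bigTensor C).obj Y ≅
      (bigTensor C).obj (Strictification.of (X.word.append Y.word)) :=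
  Word.appendIso X.word Y.word

/-- The monoidal product of the strictification is concatenation of lists, its unit is the empty
list, its associators and unitors are identities, and the product of morphisms is that of `C`. -/
instance : MonoidalCategoryStruct (Strictification C) where
  tensorObj X Y := Strictification.of (X.word.append Y.word)
  tensorUnit := Strictification.of Word.nil
  whiskerLeft X _ _ f := Strictification.homMk
    ((bigTensorμIso _ _).inv ≫ ((bigTensor C).obj X ◁ (bigTensor C).map f) ≫
      (bigTensorμIso _ _).hom)
  whiskerRight f Y := Strictification.homMk
    ((bigTensorμIso _ _).inv ≫ ((bigTensor C).map f ▷ (bigTensor C).obj Y) ≫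
      (bigTensorμIso _ _).hom)
  tensorHom f g := Strictification.homMk
    ((bigTensorμIso _ _).inv ≫ ((bigTensor C).map f ⊗ₘ (bigTensor C).map g) ≫
      (bigTensorμIso _ _).hom)
  associator X Y Z := eqToIso (Word.append_assoc X.word Y.word Z.word)
  leftUnitor X := eqToIso (Word.nil_append X.word)
  rightUnitor _ := Iso.refl _

theorem Word.snocIso_eqToHom {w w' : Word C} (h : w = w') (c : C) :
    (Word.snocIso w c).hom ≫ eqToHom (by rw [h]) =
      eqToHom (by rw [h]) ≫ (Word.snocIso w' c).hom := by
  subst h; simp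

theorem Word.eqToHom_whiskerRight {w w' : Word C} (h : w = w') (c : C) :
    eqToHom (congrArg Word.tensor h) ▷ c =
      eqToHom (congrArg (fun z => Word.tensor z ⊗ c) h) := by
  subst h; simp

theorem Word.appendIso_assoc (w₁ w₂ : Word C) : ∀ w₃ : Word C,
    ((Word.appendIso w₁ w₂).hom ▷ w₃.tensor) ≫ (Word.appendIso (w₁.append w₂) w₃).hom ≫
        eqToHom (congrArg Word.tensor (Word.append_assoc w₁ w₂ w₃)) =
      (α_ _ _ _).hom ≫ (w₁.tensor ◁ (Word.appendIso w₂ w₃).hom) ≫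
        (Word.appendIso w₁ (w₂.append w₃)).hom
  | .nil => by
      simp [Word.appendIso, Word.append, Word.tensor]
  | .snoc w₃ c => by
      have ih := Word.appendIso_assoc w₁ w₂ w₃
      have key := Word.snocIso_eqToHom (Word.append_assoc w₁ w₂ w₃) c
      have e := Word.eqToHom_whiskerRight (Word.append_assoc w₁ w₂ w₃) c
      have ih' := congrArg (fun f => f ▷ c) ih
      simp only [comp_whiskerRight, e] at ih'
      simp only [Word.appendIso, Word.append, Iso.trans_hom, whiskerLeftIso_hom, Iso.symm_hom,
        whiskerRightIso_hom, Category.assoc] at key ⊢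
      erw [key]
      rw [← cancel_epi ((w₁.tensor ⊗ w₂.tensor) ◁ (Word.snocIso w₃ c).hom),
        ← cancel_epi (α_ (w₁.tensor ⊗ w₂.tensor) w₃.tensor c).hom]
      simp only [← whisker_exchange_assoc, whiskerLeft_hom_inv_assoc]
      simp only [associator_inv_naturality_left_assoc, Iso.hom_inv_id_assoc]
      erw [reassoc_of% ih']
      simp only [whiskerLeft_comp, Category.assoc]
      simp

theorem Word.nil_appendIso : ∀ w : Word C,
    (Word.appendIso .nil w).hom ≫ eqToHom (congrArg Word.tensor (Word.nil_append w)) =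
      (λ_ w.tensor).hom
  | .nil => by
      simp [Word.appendIso, Word.append, Word.tensor, unitors_equal]
  | .snoc w c => by
      have ih := Word.nil_appendIso w
      have key := Word.snocIso_eqToHom (Word.nil_append w) c
      have e := Word.eqToHom_whiskerRight (Word.nil_append w) c
      have ih' := congrArg (fun f => f ▷ c) ih
      simp only [comp_whiskerRight, e] at ih'
      simp only [Word.appendIso, Word.append, Iso.trans_hom, whiskerLeftIso_hom, Iso.symm_hom,
        whiskerRightIso_hom, Category.assoc] at key ⊢
      erw [key]
      erw [reassoc_of% ih']
      simp [Word.tensor]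

/-- The comparison data between the monoidal structures of the strictification and of `C`. -/
def bigTensorData : Monoidal.InducingFunctorData (bigTensor C) where
  μIso := bigTensorμIso
  εIso := Iso.refl (𝟙_ C)
  whiskerLeft_eq _ _ _ _ := rfl
  whiskerRight_eq _ _ := rfl
  tensorHom_eq _ _ := rfl
  associator_eq X Y Z := by
    have h := Word.appendIso_assoc X.word Y.word Z.word
    have e : (bigTensor C).map (α_ X Y Z).hom =
        eqToHom (congrArg Word.tensor (Word.append_assoc X.word Y.word Z.word)) :=
      eqToHom_map (bigTensor C) (show (X ⊗ Y) ⊗ Z = X ⊗ (Y ⊗ Z) from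
        Word.append_assoc X.word Y.word Z.word)
    simp only [Iso.trans_hom, Iso.symm_hom, tensorIso_hom, Iso.refl_hom, tensorHom_id,
      id_tensorHom, Category.assoc]
    rw [Iso.eq_inv_comp]
    rw [← cancel_epi ((bigTensorμIso X Y).hom ▷ (bigTensor C).obj Z),
      hom_inv_whiskerRight_assoc]
    erw [e]
    exact h
  leftUnitor_eq X := by
    have h := Word.nil_appendIso X.word
    have e : (bigTensor C).map (λ_ X).hom =
        eqToHom (congrArg Word.tensor (Word.nil_append X.word)) :=
      eqToHom_map (bigTensor C) (show 𝟙_ (Strictification C) ⊗ X = X from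
        Word.nil_append X.word)
    simp only [Iso.trans_hom, Iso.symm_hom, tensorIso_hom, Iso.refl_hom, Category.assoc]
    rw [Iso.eq_inv_comp]
    erw [e]
    refine h.trans ?_
    erw [id_tensorHom_id, Category.id_comp]
    rfl
  rightUnitor_eq X := by
    simp only [Iso.trans_hom, Iso.symm_hom, tensorIso_hom, Iso.refl_hom, Category.assoc]
    rw [Iso.eq_inv_comp]
    erw [id_tensorHom_id, Category.id_comp, (bigTensor C).map_id, Category.comp_id]
    rfl

instance : MonoidalCategory (Strictification C) := Monoidal.induced (bigTensor C) bigTensorData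

instance : IsStrictMonoidal (Strictification C) where
  tensor_assoc X Y Z := Word.append_assoc X.word Y.word Z.word
  unit_tensor X := Word.nil_append X.word
  tensor_unit _ := rfl
  associator_eq _ _ _ := rfl
  leftUnitor_eq _ := rfl
  rightUnitor_eq _ := rfl

/-- `⨂` is strong monoidal, with the canonical isomorphisms as strongators. -/
instance : (bigTensor C).Monoidal := Monoidal.fromInducedMonoidal (bigTensor C) bigTensorData

end Strictification

section SymmetricStrictification

variable {C : Type u₁} [Category.{v₁} C] [MonoidalCategory C] [SymmetricCategory C]

/-- The braiding of the strictification is the one of `C`, carried along `⨂ X ⊗ ⨂ Y ≅ ⨂ (X · Y)`. -/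
def Strictification.braidingIso (X Y : Strictification C) : X ⊗ Y ≅ Y ⊗ X :=
  InducedCategory.isoMk ((bigTensorμIso X Y).symm ≪≫
    β_ ((bigTensor C).obj X) ((bigTensor C).obj Y) ≪≫ bigTensorμIso Y X)

theorem Strictification.braidingIso_spec (X Y : Strictification C) :
    Functor.LaxMonoidal.μ (bigTensor C) X Y ≫
        (bigTensor C).map (Strictification.braidingIso X Y).hom =
      (β_ ((bigTensor C).obj X) ((bigTensor C).obj Y)).hom ≫
        Functor.LaxMonoidal.μ (bigTensor C) Y X :=
  Iso.hom_inv_id_assoc (bigTensorμIso X Y) _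

instance : BraidedCategory (Strictification C) :=
  BraidedCategory.ofFaithful (bigTensor C) Strictification.braidingIso
    Strictification.braidingIso_spec

/-- `⨂` is a strong symmetric monoidal functor. -/
instance : (bigTensor C).Braided where
  braided := Strictification.braidingIso_spec

instance : SymmetricCategory (Strictification C) := SymmetricCategory.ofFaithful (bigTensor C)

end SymmetricStrictification

/-! ### The induced supply -/

section Induced

variable {C : Type u₁} [Category.{v₁} C] [MonoidalCategory C]

/-- The one-entry list `[c]` as an object of the strictification. -/
def Strictification.single (c : C) : Strictification C := Strictification.of (Word.single c)

/-- In the strictification, `[c]^{⊗n} = [c, …, c]`. -/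
theorem Strictification.tpow_single (c : C) :
    ∀ n : ℕ, tpow (Strictification.single c) n = Strictification.of (Word.replicate c n)
  | 0 => rfl
  | 1 => rfl
  | n + 2 => congrArg (fun X => X ⊗ Strictification.single c) (tpow_single c (n + 1))

/-- In the strictification, `[c₁] ⊗ ⋯ ⊗ [cₖ] = [c₁, …, cₖ]`. -/
theorem Strictification.tensor_single :
    ∀ w : Word C, (w.map Strictification.single).tensor = Strictification.of w
  | .nil => rfl
  | .snoc .nil _ => rfl
  | .snoc (.snoc w d) c =>
      congrArg (fun X => X ⊗ Strictification.single c) (tensor_single (.snoc w d))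

variable [SymmetricCategory C]
variable {P : Type u} [Category.{v} P] [MonoidalCategory P] [SymmetricCategory P] [PROP P]

/-- The morphism `s_{[c]}(μ) : [c]^{⊗m} ⟶ [c]^{⊗n}` of the strictification, which is the morphism
`s_c(μ) : c^{⊗m} ⟶ c^{⊗n}` of `C` read as a morphism `[c, …, c] ⟶ [c, …, c]`. -/
def Supply.strictSingle (s : Supply P C) (c : C) {p q : P} (μ : p ⟶ q) :
    tpow (Strictification.single c) (PROP.size p) ⟶
      tpow (Strictification.single c) (PROP.size q) :=
  eqToHom (Strictification.tpow_single c (PROP.size p)) ≫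
    (Strictification.homMk (s.map c μ) :
      Strictification.of (Word.replicate c (PROP.size p)) ⟶
        Strictification.of (Word.replicate c (PROP.size q))) ≫
    eqToHom (Strictification.tpow_single c (PROP.size q)).symm

/-- For `L = [c₁, …, cₖ]`, the morphism `L^{⊗m} ⟶ L^{⊗n}` of the strictification obtained from
`s_{[c₁]}(μ) ⊗ ⋯ ⊗ s_{[cₖ]}(μ)` by conjugating with the symmetry isomorphisms
`σ : [c₁]^{⊗m} ⊗ ⋯ ⊗ [cₖ]^{⊗m} ≅ L^{⊗m}`. -/
def Supply.strictMap (s : Supply P C) (L : Strictification C) {p q : P} (μ : p ⟶ q) :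
    tpow L (PROP.size p) ⟶ tpow L (PROP.size q) :=
  eqToHom (congrArg (fun X => tpow X (PROP.size p))
      (Strictification.tensor_single L.word).symm) ≫
    (sigmaWord Strictification.single (PROP.size p) L.word).inv ≫
    Word.tensorMap (fun c => s.strictSingle c μ) L.word ≫
    (sigmaWord Strictification.single (PROP.size q) L.word).hom ≫
    eqToHom (congrArg (fun X => tpow X (PROP.size q)) (Strictification.tensor_single L.word))

/-- `t` is the supply in the strictification induced by the supply `s` in `C`: for every object
`L` and every `μ : m ⟶ n` in `P`, the morphism `t_L(μ)` is `s.strictMap L μ`. (The functors `t_L`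
and their strongators are then determined, as `t` is a supply.) -/
def IsInducedSupply (s : Supply P C) (t : Supply P (Strictification C)) : Prop :=
  ∀ (L : Strictification C) {p q : P} (μ : p ⟶ q), t.map L μ = s.strictMap L μ

end Induced

/-!
The tensor power functors `c ↦ c^{⊗n}` are strong monoidal, with the symmetries `σ` as strongators.
Together with condition (iii) on a supply, this shows that the morphisms of `C` with respect to
which a supply `s` is natural contain the associators and unitors and are closed under `≫` and `⊗`;
in particular they contain all the strongators of the fully faithful functor `⨂`. A supply that is
natural with respect to the strongators of a fully faithful symmetric monoidal functor pulls back
along it, and the pulled back supply is preserved by construction. Pulled back along `⨂`, `s`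
agrees with `s_{[c]}` on one-entry lists, and condition (iii) then forces its value on longer lists.
-/

section TensorPowerFunctor

open Functor.LaxMonoidal

section

variable {C : Type u₁} [Category.{v₁} C] [MonoidalCategory C]

/-- The tensor power `f^{⊗n} : c^{⊗n} ⟶ d^{⊗n}` of an arbitrary morphism, extending
`tpowMapIso`. -/
def tpowMap {c d : C} (f : c ⟶ d) : ∀ n : ℕ, tpow c n ⟶ tpow d n
  | 0 => 𝟙 (𝟙_ C)
  | n + 1 => (tpowSucc c n).inv ≫ (tpowMap f n ⊗ₘ f) ≫ (tpowSucc d n).hom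

theorem tpowMap_id (c : C) : ∀ n : ℕ, tpowMap (𝟙 c) n = 𝟙 (tpow c n)
  | 0 => rfl
  | n + 1 => by simp [tpowMap, tpowMap_id c n]

theorem tpowMap_comp {c d e : C} (f : c ⟶ d) (g : d ⟶ e) :
    ∀ n : ℕ, tpowMap (f ≫ g) n = tpowMap f n ≫ tpowMap g n
  | 0 => (Category.id_comp (𝟙 (𝟙_ C))).symm
  | n + 1 => by simp [tpowMap, tpowMap_comp f g n]

theorem tpowMapIso_hom {c d : C} (f : c ≅ d) : ∀ n : ℕ, (tpowMapIso f n).hom = tpowMap f.hom n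
  | 0 => rfl
  | n + 1 => by simp [tpowMapIso, tpowMap, tpowMapIso_hom f n]

variable (C) in
/-- The tensor power `c ↦ c^{⊗n}` as a functor. -/
def tpowFunctor (n : ℕ) : C ⥤ C where
  obj c := tpow c n
  map f := tpowMap f n
  map_id c := tpowMap_id c n
  map_comp f g := tpowMap_comp f g n

variable (C) in
/-- The recursion `c^{⊗n} ⊗ c ≅ c^{⊗(n+1)}`, naturally in `c`. -/
def tpowFunctorSuccIso (n : ℕ) :
    (tpowFunctor C n).prod' (𝟭 C) ⋙ tensor C ≅ tpowFunctor C (n + 1) :=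
  NatIso.ofComponents (fun c => tpowSucc c n) fun f => by
    simp [tpowFunctor, tpowMap]

end

variable {C : Type u₁} [Category.{v₁} C] [MonoidalCategory C] [SymmetricCategory C]

/-- The tensor power functors are strong monoidal, with the symmetry isomorphisms `sigmaUnit` and
`sigmaPair` as strongators. They are built by recursion from the strong monoidal functor
`⊗ : C × C ⥤ C`. -/
instance tpowFunctorMonoidal : ∀ n : ℕ, (tpowFunctor C n).Monoidal
  | 0 => Functor.CoreMonoidal.toMonoidal
      { εIso := Iso.refl (𝟙_ C)
        μIso _ _ := λ_ (𝟙_ C)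
        μIso_hom_natural_left _ _ := by
          change (𝟙 (𝟙_ C) ▷ 𝟙_ C) ≫ (λ_ (𝟙_ C)).hom = (λ_ (𝟙_ C)).hom ≫ 𝟙 (𝟙_ C)
          simp
        μIso_hom_natural_right _ _ := by
          change (𝟙_ C ◁ 𝟙 (𝟙_ C)) ≫ (λ_ (𝟙_ C)).hom = (λ_ (𝟙_ C)).hom ≫ 𝟙 (𝟙_ C)
          simp
        associativity _ _ _ := by
          change ((λ_ (𝟙_ C)).hom ▷ 𝟙_ C) ≫ (λ_ (𝟙_ C)).hom ≫ 𝟙 (𝟙_ C) =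
            (α_ (𝟙_ C) (𝟙_ C) (𝟙_ C)).hom ≫ (𝟙_ C ◁ (λ_ (𝟙_ C)).hom) ≫ (λ_ (𝟙_ C)).hom
          monoidal
        left_unitality _ := by
          change (λ_ (𝟙_ C)).hom = (𝟙 (𝟙_ C) ▷ 𝟙_ C) ≫ (λ_ (𝟙_ C)).hom ≫ 𝟙 (𝟙_ C)
          simp
        right_unitality _ := by
          change (ρ_ (𝟙_ C)).hom = (𝟙_ C ◁ 𝟙 (𝟙_ C)) ≫ (λ_ (𝟙_ C)).hom ≫ 𝟙 (𝟙_ C)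
          monoidal }
  | n + 1 =>
      letI := tpowFunctorMonoidal n
      Functor.Monoidal.transport (tpowFunctorSuccIso C n)

theorem ε_tpowFunctor : ∀ n : ℕ, ε (tpowFunctor C n) = (sigmaUnit n).hom
  | 0 => rfl
  | n + 1 => by
      have ε_comp : ε ((tpowFunctor C n).prod' (𝟭 C) ⋙ tensor C) =
          (λ_ (𝟙_ C)).inv ≫ (ε (tpowFunctor C n) ▷ 𝟙_ C) := by
        simp only [comp_ε, tensor_ε, tensor_map, Functor.prod'_ε_fst, Functor.prod'_ε_snd, id_ε]
        exact congrArg _ (tensorHom_id _ _)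
      rw [ε_tpowFunctor n] at ε_comp
      exact (congrArg (· ≫ (tpowSucc (𝟙_ C) n).hom) ε_comp).trans (Category.assoc _ _ _)

theorem μ_tpowFunctor (c d : C) : ∀ n : ℕ, μ (tpowFunctor C n) c d = (sigmaPair c d n).hom
  | 0 => rfl
  | n + 1 => by
      have μ_comp : μ ((tpowFunctor C n).prod' (𝟭 C) ⋙ tensor C) c d =
          tensorμ (tpow c n) c (tpow d n) d ≫ (μ (tpowFunctor C n) c d ▷ (c ⊗ d)) := by
        simp only [comp_μ, tensor_μ, tensor_map, Functor.prod'_μ_fst, Functor.prod'_μ_snd, id_μ]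
        exact congrArg _ (tensorHom_id _ _)
      rw [μ_tpowFunctor c d n] at μ_comp
      exact congrArg (((tpowSucc c n).inv ⊗ₘ (tpowSucc d n).inv) ≫ ·) <|
        (congrArg (· ≫ (tpowSucc (c ⊗ d) n).hom) μ_comp).trans (Category.assoc _ _ _)

theorem sigmaPair_natural {c c' d d' : C} (f : c ⟶ c') (g : d ⟶ d') (n : ℕ) :
    (tpowMap f n ⊗ₘ tpowMap g n) ≫ (sigmaPair c' d' n).hom =
      (sigmaPair c d n).hom ≫ tpowMap (f ⊗ₘ g) n := by
  simp only [← μ_tpowFunctor]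
  exact μ_natural (tpowFunctor C n) f g

theorem sigmaPair_associativity (a b c : C) (n : ℕ) :
    ((sigmaPair a b n).hom ▷ tpow c n) ≫ (sigmaPair (a ⊗ b) c n).hom ≫ tpowMap (α_ a b c).hom n =
      (α_ (tpow a n) (tpow b n) (tpow c n)).hom ≫ (tpow a n ◁ (sigmaPair b c n).hom) ≫
        (sigmaPair a (b ⊗ c) n).hom := by
  simp only [← μ_tpowFunctor]
  exact associativity (tpowFunctor C n) a b c

theorem sigmaUnit_left_unitality (c : C) (n : ℕ) :
    (λ_ (tpow c n)).hom =
      ((sigmaUnit n).hom ▷ tpow c n) ≫ (sigmaPair (𝟙_ C) c n).hom ≫ tpowMap (λ_ c).hom n := by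
  simp only [← ε_tpowFunctor, ← μ_tpowFunctor]
  exact left_unitality (tpowFunctor C n) c

theorem sigmaUnit_right_unitality (c : C) (n : ℕ) :
    (ρ_ (tpow c n)).hom =
      (tpow c n ◁ (sigmaUnit n).hom) ≫ (sigmaPair c (𝟙_ C) n).hom ≫ tpowMap (ρ_ c).hom n := by
  simp only [← ε_tpowFunctor, ← μ_tpowFunctor]
  exact right_unitality (tpowFunctor C n) c

end TensorPowerFunctor

namespace Supply

variable {P : Type u} [Category.{v} P] [MonoidalCategory P] [SymmetricCategory P] [PROP P]
  {C : Type u₁} [Category.{v₁} C] [MonoidalCategory C] [SymmetricCategory C] (s : Supply P C)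

theorem map_id (c : C) (p : P) : s.map c (𝟙 p) = 𝟙 _ := by
  simp [Supply.map]

theorem map_comp (c : C) {p q r : P} (μ : p ⟶ q) (ν : q ⟶ r) :
    s.map c (μ ≫ ν) = s.map c μ ≫ s.map c ν := by
  simp [Supply.map]

theorem map_eqToHom {c d : C} (h : c = d) {p q : P} (μ : p ⟶ q) :
    s.map d μ = eqToHom (congrArg (fun X => tpow X (PROP.size p)) h.symm) ≫ s.map c μ ≫
      eqToHom (congrArg (fun X => tpow X (PROP.size q)) h) := by
  subst h
  simp

theorem functor_map_eq (c : C) {p q : P} (μ : p ⟶ q) :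
    (s.functor c).map μ =
      eqToHom (s.obj_eq c p) ≫ s.map c μ ≫ eqToHom (s.obj_eq c q).symm := by
  simp [Supply.map]

theorem map_sigmaPair (c d : C) {p q : P} (μ : p ⟶ q) :
    (s.map c μ ⊗ₘ s.map d μ) ≫ (sigmaPair c d (PROP.size q)).hom =
      (sigmaPair c d (PROP.size p)).hom ≫ s.map (c ⊗ d) μ :=
  s.map_tensor c d μ

theorem sigmaUnit_map {p q : P} (μ : p ⟶ q) :
    (sigmaUnit (PROP.size p)).hom ≫ s.map (𝟙_ C) μ = (sigmaUnit (PROP.size q)).hom :=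
  (s.map_unit μ).symm

/-- The morphisms `f` of `C` whose tensor powers commute with all the supplied morphisms. A supply
need not be natural in `C`, but it is natural with respect to the coherence isomorphisms. -/
def naturalMorphisms : MorphismProperty C := fun c d f =>
  ∀ ⦃p q : P⦄ (μ : p ⟶ q),
    tpowMap f (PROP.size p) ≫ s.map d μ = s.map c μ ≫ tpowMap f (PROP.size q)

theorem naturalMorphisms_inv {c d : C} (f : c ≅ d) (hf : s.naturalMorphisms f.hom) :
    s.naturalMorphisms f.inv := by
  intro p q μ
  have hom_inv_id (n : ℕ) : tpowMap f.hom n ≫ tpowMap f.inv n = 𝟙 _ := by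
    rw [← tpowMap_comp, f.hom_inv_id, tpowMap_id]
  rw [← cancel_epi (tpowMapIso f (PROP.size p)).hom, tpowMapIso_hom,
    reassoc_of% hom_inv_id, reassoc_of% hf μ, hom_inv_id, Category.comp_id]

instance : s.naturalMorphisms.IsMultiplicative where
  id_mem c p q μ := by rw [tpowMap_id, tpowMap_id, Category.id_comp, Category.comp_id]
  comp_mem f g hf hg p q μ := by
    rw [tpowMap_comp, tpowMap_comp, Category.assoc, hg μ, reassoc_of% hf μ]

instance : s.naturalMorphisms.IsMonoidal := .mk' _ fun {c c' d d'} f g hf hg p q μ => by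
  rw [← cancel_epi (sigmaPair c d (PROP.size p)).hom, ← reassoc_of% sigmaPair_natural,
    ← map_sigmaPair, ← reassoc_of% map_sigmaPair, ← sigmaPair_natural,
    tensorHom_comp_tensorHom_assoc, tensorHom_comp_tensorHom_assoc, hf μ, hg μ]

theorem naturalMorphisms_associator_hom (a b c : C) : s.naturalMorphisms (α_ a b c).hom := by
  intro p q μ
  have left : ((sigmaPair a b (PROP.size p)).hom ▷ _) ≫ (s.map (a ⊗ b) μ ⊗ₘ s.map c μ) =
      ((s.map a μ ⊗ₘ s.map b μ) ⊗ₘ s.map c μ) ≫ ((sigmaPair a b (PROP.size q)).hom ▷ _) := by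
    simp only [whiskerRight_comp_tensorHom, tensorHom_comp_whiskerRight, map_sigmaPair]
  have right : (_ ◁ (sigmaPair b c (PROP.size p)).hom) ≫ (s.map a μ ⊗ₘ s.map (b ⊗ c) μ) =
      (s.map a μ ⊗ₘ (s.map b μ ⊗ₘ s.map c μ)) ≫ (_ ◁ (sigmaPair b c (PROP.size q)).hom) := by
    simp only [whiskerLeft_comp_tensorHom, tensorHom_comp_whiskerLeft, map_sigmaPair]
  rw [← cancel_epi (sigmaPair (a ⊗ b) c (PROP.size p)).hom,
    ← cancel_epi ((sigmaPair a b (PROP.size p)).hom ▷ tpow c (PROP.size p)),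
    reassoc_of% sigmaPair_associativity, ← map_sigmaPair, ← reassoc_of% map_sigmaPair,
    reassoc_of% left, reassoc_of% right, sigmaPair_associativity, associator_naturality_assoc]

theorem naturalMorphisms_leftUnitor_hom (c : C) : s.naturalMorphisms (λ_ c).hom := by
  intro p q μ
  have unit : ((sigmaUnit (PROP.size p)).hom ▷ _) ≫ (s.map (𝟙_ C) μ ⊗ₘ s.map c μ) =
      (𝟙_ C ◁ s.map c μ) ≫ ((sigmaUnit (PROP.size q)).hom ▷ _) := by
    rw [whiskerRight_comp_tensorHom, sigmaUnit_map, MonoidalCategory.tensorHom_def']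
  rw [← cancel_epi (sigmaPair (𝟙_ C) c (PROP.size p)).hom,
    ← cancel_epi ((sigmaUnit (PROP.size p)).hom ▷ tpow c (PROP.size p)),
    ← reassoc_of% sigmaUnit_left_unitality, ← reassoc_of% map_sigmaPair, reassoc_of% unit,
    ← sigmaUnit_left_unitality, leftUnitor_naturality]

theorem naturalMorphisms_rightUnitor_hom (c : C) : s.naturalMorphisms (ρ_ c).hom := by
  intro p q μ
  have unit : (_ ◁ (sigmaUnit (PROP.size p)).hom) ≫ (s.map c μ ⊗ₘ s.map (𝟙_ C) μ) =
      (s.map c μ ▷ 𝟙_ C) ≫ (_ ◁ (sigmaUnit (PROP.size q)).hom) := by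
    rw [whiskerLeft_comp_tensorHom, sigmaUnit_map, MonoidalCategory.tensorHom_def]
  rw [← cancel_epi (sigmaPair c (𝟙_ C) (PROP.size p)).hom,
    ← cancel_epi (tpow c (PROP.size p) ◁ (sigmaUnit (PROP.size p)).hom),
    ← reassoc_of% sigmaUnit_right_unitality, ← reassoc_of% map_sigmaPair, reassoc_of% unit,
    ← sigmaUnit_right_unitality, rightUnitor_naturality]

instance : s.naturalMorphisms.IsMonoidalStable where
  associator_hom_mem := s.naturalMorphisms_associator_hom
  associator_inv_mem a b c := s.naturalMorphisms_inv _ (s.naturalMorphisms_associator_hom a b c)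
  leftUnitor_hom_mem := s.naturalMorphisms_leftUnitor_hom
  leftUnitor_inv_mem c := s.naturalMorphisms_inv _ (s.naturalMorphisms_leftUnitor_hom c)
  rightUnitor_hom_mem := s.naturalMorphisms_rightUnitor_hom
  rightUnitor_inv_mem c := s.naturalMorphisms_inv _ (s.naturalMorphisms_rightUnitor_hom c)

end Supply

namespace Word

variable {C : Type u₁} [Category.{v₁} C] [MonoidalCategory C] (W : MorphismProperty C)
  [W.IsMonoidalStable]

theorem snocIso_hom_mem : ∀ (w : Word C) (c : C), W (snocIso w c).hom
  | .nil, c => W.leftUnitor_hom_mem c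
  | .snoc _ _, _ => W.id_mem _

theorem snocIso_inv_mem : ∀ (w : Word C) (c : C), W (snocIso w c).inv
  | .nil, c => W.leftUnitor_inv_mem c
  | .snoc _ _, _ => W.id_mem _

theorem appendIso_hom_mem (w : Word C) : ∀ w' : Word C, W (appendIso w w').hom
  | .nil => W.rightUnitor_hom_mem _
  | .snoc w' c =>
      W.comp_mem _ _ (W.whiskerLeft_mem _ _ (snocIso_inv_mem W w' c)) <|
        W.comp_mem _ _ (W.associator_inv_mem _ _ _) <|
          W.comp_mem _ _ (W.whiskerRight_mem _ (appendIso_hom_mem w w') c) <|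
            snocIso_hom_mem W _ c

end Word

theorem Supply.tensorMap_sigmaWord {P : Type u} [Category.{v} P] [MonoidalCategory P]
    [SymmetricCategory P] [PROP P] {C : Type u₁} [Category.{v₁} C] [MonoidalCategory C]
    [SymmetricCategory C] (s : Supply P C) {ι : Type u₂} (X : ι → C) {p q : P} (μ : p ⟶ q) :
    ∀ w : Word ι,
      Word.tensorMap (fun i => s.map (X i) μ) w ≫ (sigmaWord X (PROP.size q) w).hom =
        (sigmaWord X (PROP.size p) w).hom ≫ s.map (w.map X).tensor μ
  | .nil => (Category.id_comp _).trans (s.sigmaUnit_map μ).symm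
  | .snoc w i => by
      have snoc_natural := Word.snocIso_hom_mem s.naturalMorphisms (w.map X) (X i) μ
      simp only [← tpowMapIso_hom] at snoc_natural
      change ((Word.snocIso _ _).inv ≫
          (Word.tensorMap (fun i => s.map (X i) μ) w ⊗ₘ s.map (X i) μ) ≫
            (Word.snocIso _ _).hom) ≫
          (Word.snocIso _ _).inv ≫ ((sigmaWord X (PROP.size q) w).hom ▷ _) ≫
            (sigmaPair _ _ (PROP.size q)).hom ≫ (tpowMapIso _ (PROP.size q)).hom =
        ((Word.snocIso _ _).inv ≫ ((sigmaWord X (PROP.size p) w).hom ▷ _) ≫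
          (sigmaPair _ _ (PROP.size p)).hom ≫ (tpowMapIso _ (PROP.size p)).hom) ≫
            s.map (Word.snoc (w.map X) (X i)).tensor μ
      simp only [Category.assoc, Iso.hom_inv_id_assoc, snoc_natural]
      rw [tensorHom_comp_whiskerRight_assoc, tensorMap_sigmaWord s X μ w,
        ← whiskerRight_comp_tensorHom_assoc, reassoc_of% map_sigmaPair]

section Strongators

open Functor.LaxMonoidal

variable {C : Type u₁} [Category.{v₁} C] [MonoidalCategory C]
  {D : Type u₂} [Category.{v₂} D] [MonoidalCategory D] (F : C ⥤ D)

section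

variable [F.Monoidal]

theorem tpowSucc_tpowStrongator (c : C) (n : ℕ) :
    (tpowSucc (F.obj c) n).hom ≫ (tpowStrongator F c (n + 1)).hom =
      ((tpowStrongator F c n).hom ▷ F.obj c) ≫ μ F (tpow c n) c ≫ F.map (tpowSucc c n).hom :=
  Iso.hom_inv_id_assoc (tpowSucc (F.obj c) n) _

theorem tpowStrongator_eqToHom (c : C) {m n : ℕ} (h : m = n) :
    (tpowStrongator F c m).hom ≫ F.map (eqToHom (congrArg (tpow c) h)) =
      eqToHom (congrArg (tpow (F.obj c)) h) ≫ (tpowStrongator F c n).hom := by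
  subst h
  simp

theorem tpowSucc_tpowAdd (c : C) (m n : ℕ) :
    (tpow c m ◁ (tpowSucc c n).hom) ≫ (tpowAdd c m (n + 1)).hom =
      (α_ (tpow c m) (tpow c n) c).inv ≫ ((tpowAdd c m n).hom ▷ c) ≫ (tpowSucc c (m + n)).hom :=
  whiskerLeft_hom_inv_assoc _ (tpowSucc c n) _

theorem tpowStrongator_tpowAdd (c : C) (m : ℕ) : ∀ n : ℕ,
    ((tpowStrongator F c m).hom ⊗ₘ (tpowStrongator F c n).hom) ≫ μ F (tpow c m) (tpow c n) ≫
        F.map (tpowAdd c m n).hom =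
      (tpowAdd (F.obj c) m n).hom ≫ (tpowStrongator F c (m + n)).hom
  | 0 => by
      change ((tpowStrongator F c m).hom ⊗ₘ ε F) ≫ μ F (tpow c m) (𝟙_ C) ≫
        F.map (ρ_ (tpow c m)).hom = (ρ_ (tpow (F.obj c) m)).hom ≫ (tpowStrongator F c m).hom
      rw [← rightUnitor_naturality, right_unitality, tensorHom_def_assoc]
  | n + 1 => by
      have ih := congrArg (· ▷ F.obj c) (tpowStrongator_tpowAdd c m n)
      simp only [comp_whiskerRight] at ih
      have succ_right : (tpow (F.obj c) m ◁ (tpowSucc (F.obj c) n).hom) ≫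
          ((tpowStrongator F c m).hom ⊗ₘ (tpowStrongator F c (n + 1)).hom) =
          ((tpowStrongator F c m).hom ⊗ₘ ((tpowStrongator F c n).hom ▷ F.obj c)) ≫
            (F.obj (tpow c m) ◁ μ F (tpow c n) c) ≫
              (F.obj (tpow c m) ◁ F.map (tpowSucc c n).hom) := by
        rw [whiskerLeft_comp_tensorHom, tpowSucc_tpowStrongator, tensorHom_comp_whiskerLeft_assoc,
          tensorHom_comp_whiskerLeft, Category.assoc]
      have reassociate : ((tpowStrongator F c m).hom ⊗ₘ ((tpowStrongator F c n).hom ▷ F.obj c)) ≫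
          (α_ _ _ _).inv =
          (α_ _ _ _).inv ≫
            (((tpowStrongator F c m).hom ⊗ₘ (tpowStrongator F c n).hom) ▷ F.obj c) := by
        simpa only [tensorHom_id] using associator_inv_naturality
          (tpowStrongator F c m).hom (tpowStrongator F c n).hom (𝟙 (F.obj c))
      rw [← cancel_epi (tpow (F.obj c) m ◁ (tpowSucc (F.obj c) n).hom), reassoc_of% succ_right,
        μ_natural_right_assoc, ← F.map_comp, tpowSucc_tpowAdd, F.map_comp, F.map_comp,
        associativity_inv_assoc, reassoc_of% reassociate, reassoc_of% tpowSucc_tpowAdd,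
        ← μ_natural_left_assoc, reassoc_of% ih]
      exact congrArg _ (congrArg _ (tpowSucc_tpowStrongator F c (m + n)).symm)

theorem tpowStrongator_sigmaUnit : ∀ n : ℕ,
    ε F ≫ F.map (sigmaUnit n).hom =
      (sigmaUnit n).hom ≫ tpowMap (ε F) n ≫ (tpowStrongator F (𝟙_ C) n).hom
  | 0 => by
      change ε F ≫ F.map (𝟙 (𝟙_ C)) = 𝟙 (𝟙_ D) ≫ 𝟙 (𝟙_ D) ≫ ε F
      simp
  | n + 1 => by
      have ih := congrArg (· ▷ 𝟙_ D) (tpowStrongator_sigmaUnit n)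
      simp only [comp_whiskerRight] at ih
      simp only [tpowMap, sigmaUnit, Iso.trans_hom, Iso.symm_hom, whiskerRightIso_hom,
        Category.assoc, Iso.hom_inv_id_assoc, tpowSucc_tpowStrongator, F.map_comp]
      rw [MonoidalCategory.tensorHom_def, Category.assoc, whisker_exchange_assoc,
        ← reassoc_of% ih, ← left_unitality_inv, Category.assoc,
        leftUnitor_inv_naturality_assoc, Category.assoc, ← μ_natural_left_assoc,
        whisker_exchange_assoc, whisker_exchange_assoc]

end

variable [SymmetricCategory C] [SymmetricCategory D] [F.Braided]

theorem tpowSucc_sigmaPair (c d : C) (n : ℕ) :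
    ((tpowSucc c n).hom ⊗ₘ (tpowSucc d n).hom) ≫ (sigmaPair c d (n + 1)).hom =
      tensorμ (tpow c n) c (tpow d n) d ≫
        ((sigmaPair c d n).hom ▷ (c ⊗ d)) ≫ (tpowSucc (c ⊗ d) n).hom :=
  Iso.hom_inv_id_assoc (tpowSucc c n ⊗ᵢ tpowSucc d n) _

theorem tpowStrongator_sigmaPair (c d : C) : ∀ n : ℕ,
    ((tpowStrongator F c n).hom ⊗ₘ (tpowStrongator F d n).hom) ≫
        μ F (tpow c n) (tpow d n) ≫ F.map (sigmaPair c d n).hom =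
      (sigmaPair (F.obj c) (F.obj d) n).hom ≫ tpowMap (μ F c d) n ≫
        (tpowStrongator F (c ⊗ d) n).hom
  | 0 => by
      change (ε F ⊗ₘ ε F) ≫ μ F (𝟙_ C) (𝟙_ C) ≫ F.map (λ_ (𝟙_ C)).hom =
        (λ_ (𝟙_ D)).hom ≫ 𝟙 (𝟙_ D) ≫ ε F
      rw [Category.id_comp, ← leftUnitor_naturality, left_unitality, tensorHom_def'_assoc]
  | n + 1 => by
      have succ : ((tpowSucc (F.obj c) n).hom ⊗ₘ (tpowSucc (F.obj d) n).hom) ≫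
          ((tpowStrongator F c (n + 1)).hom ⊗ₘ (tpowStrongator F d (n + 1)).hom) =
          (((tpowStrongator F c n).hom ⊗ₘ 𝟙 _) ⊗ₘ ((tpowStrongator F d n).hom ⊗ₘ 𝟙 _)) ≫
            (μ F (tpow c n) c ⊗ₘ μ F (tpow d n) d) ≫
              (F.map (tpowSucc c n).hom ⊗ₘ F.map (tpowSucc d n).hom) := by
        simp only [tensorHom_comp_tensorHom, tpowSucc_tpowStrongator, tensorHom_id]
      rw [← cancel_epi ((tpowSucc (F.obj c) n).hom ⊗ₘ (tpowSucc (F.obj d) n).hom),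
        reassoc_of% succ, μ_natural_assoc, ← F.map_comp, tpowSucc_sigmaPair,
        reassoc_of% tpowSucc_sigmaPair, tpowMap, F.map_comp, F.map_comp,
        ← tensorμ_comp_μ_tensorHom_μ_comp_μ_assoc, tensorμ_natural_assoc,
        Category.assoc, Category.assoc, tpowSucc_tpowStrongator, Iso.hom_inv_id_assoc,
        ← μ_natural_left_assoc]
      simp only [← tensorHom_id, tensorHom_comp_tensorHom_assoc, tpowStrongator_sigmaPair c d n,
        Category.id_comp, Category.comp_id, id_tensorHom_id]

end Strongators

section FullyFaithful

open Functor.LaxMonoidal Functor.Monoidal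
open Functor.OplaxMonoidal (δ)

variable {A : Type u} [Category.{v} A] [MonoidalCategory A]
  {C : Type u₁} [Category.{v₁} C] [MonoidalCategory C]
  {D : Type u₂} [Category.{v₂} D] [MonoidalCategory D]
  (T : A ⥤ C) (F : C ⥤ D) [F.Full] [F.Faithful]

/-- A monoidal structure on `T ⋙ F`, where `F` is fully faithful and monoidal, lifts to `T`. -/
noncomputable abbrev monoidalOfComp [F.Monoidal] [(T ⋙ F).Monoidal] : T.Monoidal :=
  Functor.CoreMonoidal.toMonoidal
    { εIso := F.preimageIso ((εIso F).symm ≪≫ εIso (T ⋙ F))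
      μIso a b := F.preimageIso ((μIso F _ _).symm ≪≫ μIso (T ⋙ F) a b)
      μIso_hom_natural_left f b := F.map_injective <| by
        simp only [Functor.preimageIso_hom, F.map_comp, Functor.map_preimage, Iso.trans_hom,
          Iso.symm_hom, μIso_inv, μIso_hom, ← Functor.OplaxMonoidal.δ_natural_left_assoc,
          Category.assoc]
        exact congrArg _ (μ_natural_left (T ⋙ F) f b)
      μIso_hom_natural_right b f := F.map_injective <| by
        simp only [Functor.preimageIso_hom, F.map_comp, Functor.map_preimage, Iso.trans_hom,
          Iso.symm_hom, μIso_inv, μIso_hom, ← Functor.OplaxMonoidal.δ_natural_right_assoc,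
          Category.assoc]
        exact congrArg _ (μ_natural_right (T ⋙ F) b f)
      associativity a b c := F.map_injective <| by
        simp only [Functor.preimageIso_hom, F.map_comp, Functor.map_preimage, Iso.trans_hom,
          Iso.symm_hom, μIso_inv, μIso_hom, map_whiskerLeft, map_whiskerRight, map_associator,
          comp_whiskerRight, MonoidalCategory.whiskerLeft_comp, Category.assoc, μ_δ_assoc,
          whiskerLeft_μ_δ_assoc]
        exact congrArg _ (congrArg _ (associativity (T ⋙ F) a b c))
      left_unitality a := F.map_injective <| by
        simp only [Functor.preimageIso_hom, F.map_comp, Functor.map_preimage, Iso.trans_hom,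
          Iso.symm_hom, μIso_inv, μIso_hom, εIso_inv, εIso_hom, map_whiskerRight, map_leftUnitor,
          comp_whiskerRight, Category.assoc, μ_δ_assoc]
        exact congrArg _ (congrArg _ (left_unitality (T ⋙ F) a))
      right_unitality a := F.map_injective <| by
        simp only [Functor.preimageIso_hom, F.map_comp, Functor.map_preimage, Iso.trans_hom,
          Iso.symm_hom, μIso_inv, μIso_hom, εIso_inv, εIso_hom, map_whiskerLeft, map_rightUnitor,
          MonoidalCategory.whiskerLeft_comp, Category.assoc, μ_δ_assoc]
        exact congrArg _ (congrArg _ (right_unitality (T ⋙ F) a)) }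

theorem map_μ_monoidalOfComp [F.Monoidal] [(T ⋙ F).Monoidal] (a b : A) :
    F.map ((monoidalOfComp T F).toLaxMonoidal.μ a b) =
      δ F (T.obj a) (T.obj b) ≫ μ (T ⋙ F) a b :=
  F.map_preimage _

/-- A braided monoidal structure on `T ⋙ F`, where `F` is fully faithful and braided, lifts to
`T`. -/
noncomputable abbrev braidedOfComp [BraidedCategory A] [BraidedCategory C] [BraidedCategory D]
    [F.Braided] [(T ⋙ F).Braided] : T.Braided where
  __ := monoidalOfComp T F
  braided a b := F.map_injective <| by
    have braided := Functor.LaxBraided.braided (F := T ⋙ F) a b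
    rw [Functor.comp_map] at braided
    rw [F.map_comp, F.map_comp, map_μ_monoidalOfComp, map_μ_monoidalOfComp, Category.assoc,
      braided, Functor.map_braiding]
    simp

end FullyFaithful

namespace Supply

open Functor.LaxMonoidal
open Functor.OplaxMonoidal (δ)

variable {P : Type u} [Category.{v} P] [MonoidalCategory P] [SymmetricCategory P] [PROP P]
  {C : Type u₁} [Category.{v₁} C] [MonoidalCategory C] [SymmetricCategory C]
  {D : Type u₂} [Category.{v₂} D] [MonoidalCategory D] [SymmetricCategory D]
  (s : Supply P C) (F : D ⥤ C) [F.Braided]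

variable {s F} in
theorem preservesSupply_of_map {t : Supply P D} (h : ∀ (d : D) {p q : P} (μ : p ⟶ q),
    (tpowStrongator F d (PROP.size p)).hom ≫ F.map (t.map d μ) =
      s.map (F.obj d) μ ≫ (tpowStrongator F d (PROP.size q)).hom) :
    PreservesSupply F t s := fun d =>
  ⟨NatIso.ofComponents
    (fun p => eqToIso (s.obj_eq (F.obj d) p) ≪≫ tpowStrongator F d (PROP.size p) ≪≫
      F.mapIso (eqToIso (t.obj_eq d p).symm))
    (fun {p q} μ => by
      simp only [Iso.trans_hom, eqToIso.hom, Functor.mapIso_hom, Functor.comp_map,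
        functor_map_eq, F.map_comp, eqToHom_map, Category.assoc, eqToHom_trans_assoc,
        eqToHom_refl, Category.id_comp, reassoc_of% h d μ]), fun _ => rfl⟩

variable [F.Full]

/-- The morphism of `D` that `F` sends to `s_{F(d)}(μ)`, up to the strongators of `F`. -/
noncomputable def pullbackMap (d : D) {p q : P} (μ : p ⟶ q) :
    tpow d (PROP.size p) ⟶ tpow d (PROP.size q) :=
  F.preimage ((tpowStrongator F d (PROP.size p)).inv ≫ s.map (F.obj d) μ ≫
    (tpowStrongator F d (PROP.size q)).hom)

theorem map_pullbackMap (d : D) {p q : P} (μ : p ⟶ q) :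
    F.map (s.pullbackMap F d μ) = (tpowStrongator F d (PROP.size p)).inv ≫
      s.map (F.obj d) μ ≫ (tpowStrongator F d (PROP.size q)).hom :=
  F.map_preimage _

theorem tpowStrongator_map_pullbackMap (d : D) {p q : P} (μ : p ⟶ q) :
    (tpowStrongator F d (PROP.size p)).hom ≫ F.map (s.pullbackMap F d μ) =
      s.map (F.obj d) μ ≫ (tpowStrongator F d (PROP.size q)).hom := by
  rw [map_pullbackMap, Iso.hom_inv_id_assoc]

variable [F.Faithful]

variable {F} in
theorem pullbackMap_sigmaPair {c d : D} (hμ : s.naturalMorphisms (μ F c d))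
    {p q : P} (f : p ⟶ q) :
    (s.pullbackMap F c f ⊗ₘ s.pullbackMap F d f) ≫ (sigmaPair c d (PROP.size q)).hom =
      (sigmaPair c d (PROP.size p)).hom ≫ s.pullbackMap F (c ⊗ d) f := by
  apply F.map_injective
  rw [← cancel_epi (μ F _ _),
    ← cancel_epi ((tpowStrongator F c (PROP.size p)).hom ⊗ₘ
      (tpowStrongator F d (PROP.size p)).hom), F.map_comp, F.map_comp,
    ← μ_natural_assoc, reassoc_of% tpowStrongator_sigmaPair,
    tensorHom_comp_tensorHom_assoc, tpowStrongator_map_pullbackMap,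
    tpowStrongator_map_pullbackMap, tpowStrongator_map_pullbackMap, reassoc_of% hμ f,
    ← reassoc_of% map_sigmaPair, ← tpowStrongator_sigmaPair, tensorHom_comp_tensorHom_assoc]

variable {F} in
theorem sigmaUnit_pullbackMap (hε : s.naturalMorphisms (ε F)) {p q : P} (f : p ⟶ q) :
    (sigmaUnit (PROP.size p)).hom ≫ s.pullbackMap F (𝟙_ D) f = (sigmaUnit (PROP.size q)).hom := by
  apply F.map_injective
  rw [← cancel_epi (ε F), F.map_comp, reassoc_of% tpowStrongator_sigmaUnit,
    tpowStrongator_map_pullbackMap, reassoc_of% hε f, tpowStrongator_sigmaUnit,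
    reassoc_of% sigmaUnit_map]

/-- The functor `P ⥤ D` given by the tensor powers of `d` and the morphisms
`Supply.pullbackMap`. -/
noncomputable def pullbackFunctor (d : D) : P ⥤ D where
  obj p := tpow d (PROP.size p)
  map f := s.pullbackMap F d f
  map_id p := F.map_injective <| by simp [map_pullbackMap, map_id]
  map_comp f g := F.map_injective <| by simp [map_pullbackMap, map_comp]

/-- The strongators of `F` identify `s_{F(d)}` with `s.pullbackFunctor F d ⋙ F`. -/
noncomputable def pullbackFunctorIso (d : D) :
    s.functor (F.obj d) ≅ s.pullbackFunctor F d ⋙ F :=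
  NatIso.ofComponents
    (fun p => eqToIso (s.obj_eq (F.obj d) p) ≪≫ tpowStrongator F d (PROP.size p))
    (fun {p q} f => by
      simp [pullbackFunctor, tpowStrongator_map_pullbackMap, functor_map_eq])

/-- The symmetric monoidal structure of `s_{F(d)}`, transported to `s.pullbackFunctor F d ⋙ F`. -/
noncomputable abbrev pullbackFunctorCompBraided (d : D) : (s.pullbackFunctor F d ⋙ F).Braided :=
  letI := s.braided (F.obj d)
  letI := Functor.Monoidal.transport (s.pullbackFunctorIso F d)
  haveI := Functor.Monoidal.natTransIsMonoidal_of_transport (s.pullbackFunctorIso F d)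
  { toMonoidal := inferInstance
    braided := (Functor.LaxBraided.ofNatIso (s.pullbackFunctorIso F d)).braided }

/-- The symmetric monoidal structure on `s.pullbackFunctor F d` inherited from `s_{F(d)}`. -/
noncomputable abbrev pullbackFunctorBraided (d : D) : (s.pullbackFunctor F d).Braided :=
  letI := s.pullbackFunctorCompBraided F d
  braidedOfComp (s.pullbackFunctor F d) F

theorem map_μ_pullbackFunctor (d : D) (p q : P) :
    letI := s.braided (F.obj d)
    letI := s.pullbackFunctorBraided F d
    F.map (μ (s.pullbackFunctor F d) p q) = δ F _ _ ≫
      ((s.pullbackFunctorIso F d).inv.app p ⊗ₘ (s.pullbackFunctorIso F d).inv.app q) ≫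
        μ (s.functor (F.obj d)) p q ≫ (s.pullbackFunctorIso F d).hom.app (p ⊗ q) :=
  F.map_preimage _

theorem μ_pullbackFunctor (d : D) (p q : P) :
    letI := s.pullbackFunctorBraided F d
    μ (s.pullbackFunctor F d) p q = (tpowAdd d (PROP.size p) (PROP.size q)).hom ≫
      eqToHom (congrArg (tpow d) (PROP.size_tensor p q).symm) := by
  let := s.braided (F.obj d)
  apply F.map_injective
  rw [map_μ_pullbackFunctor, s.strongator_eq]
  change δ F (tpow d (PROP.size p)) (tpow d (PROP.size q)) ≫
    (((tpowStrongator F d (PROP.size p)).inv ≫ eqToHom (s.obj_eq _ p).symm) ⊗ₘ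
      ((tpowStrongator F d (PROP.size q)).inv ≫ eqToHom (s.obj_eq _ q).symm)) ≫
      ((eqToHom _ ⊗ₘ eqToHom _) ≫ (tpowAdd (F.obj d) _ _).hom ≫ eqToHom _) ≫
        eqToHom (s.obj_eq _ _) ≫ (tpowStrongator F d (PROP.size (p ⊗ q))).hom =
    F.map (X := tpow d (PROP.size p) ⊗ tpow d (PROP.size q)) (Y := tpow d (PROP.size (p ⊗ q)))
      ((tpowAdd d (PROP.size p) (PROP.size q)).hom ≫ eqToHom _)
  rw [← cancel_epi (μ F _ _), ← cancel_epi ((tpowStrongator F d (PROP.size p)).hom ⊗ₘ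
      (tpowStrongator F d (PROP.size q)).hom), F.map_comp,
    reassoc_of% tpowStrongator_tpowAdd,
    tpowStrongator_eqToHom F d (PROP.size_tensor p q).symm]
  simp

/-- The supply in `D` obtained from a supply in `C` along a fully faithful symmetric monoidal
functor `F : D ⥤ C` with respect to whose strongators the supply is natural. -/
noncomputable def pullback (hε : s.naturalMorphisms (ε F))
    (hμ : ∀ X Y, s.naturalMorphisms (μ F X Y)) : Supply P D where
  functor := s.pullbackFunctor F
  braided := s.pullbackFunctorBraided F
  obj_eq _ _ := rfl
  strongator_eq d p q := (s.μ_pullbackFunctor F d p q).trans <| by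
    change _ = (𝟙 _ ⊗ₘ 𝟙 _) ≫ _
    rw [id_tensorHom_id]
    exact (Category.id_comp _).symm
  map_tensor c d p q f := by
    change ((𝟙 _ ≫ s.pullbackMap F c f ≫ 𝟙 _) ⊗ₘ (𝟙 _ ≫ s.pullbackMap F d f ≫ 𝟙 _)) ≫ _ =
      _ ≫ 𝟙 _ ≫ s.pullbackMap F (c ⊗ d) f ≫ 𝟙 _
    simpa only [Category.id_comp, Category.comp_id] using s.pullbackMap_sigmaPair (hμ c d) f
  map_unit f := by
    change _ = _ ≫ 𝟙 _ ≫ s.pullbackMap F (𝟙_ D) f ≫ 𝟙 _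
    simpa only [Category.id_comp, Category.comp_id] using (s.sigmaUnit_pullbackMap hε f).symm

theorem pullback_map (hε : s.naturalMorphisms (ε F))
    (hμ : ∀ X Y, s.naturalMorphisms (μ F X Y)) (d : D) {p q : P} (f : p ⟶ q) :
    (s.pullback F hε hμ).map d f = s.pullbackMap F d f :=
  (Category.id_comp _).trans (Category.comp_id _)

end Supply

namespace Word

variable {C : Type u₁} [Category.{v₁} C] [MonoidalCategory C]

theorem appendIso_single_hom (w : Word C) (c : C) :
    (appendIso w (single c)).hom = (snocIso w c).hom := by
  change (w.tensor ◁ (λ_ c).inv) ≫ (α_ w.tensor (𝟙_ C) c).inv ≫ ((ρ_ w.tensor).hom ▷ c) ≫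
    (snocIso w c).hom = _
  simp

theorem eqToHom_whiskerRight_snocIso {w w' : Word C} (h : w = w') (c : C) :
    (eqToHom (congrArg tensor h) ▷ c) ≫ (snocIso w' c).hom =
      (snocIso w c).hom ≫ eqToHom (congrArg (fun z => (snoc z c).tensor) h) := by
  subst h
  simp

end Word

namespace Strictification

variable {C : Type u₁} [Category.{v₁} C] [MonoidalCategory C]

theorem tpowStrongator_single (c : C) : ∀ n : ℕ,
    (tpowStrongator (bigTensor C) (single c) n).hom =
      eqToHom (congrArg (bigTensor C).obj (tpow_single c n).symm)
  | 0 => rfl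
  | 1 => (Iso.inv_comp_eq (λ_ ((bigTensor C).obj (single c)))).mpr <|
      (Functor.LaxMonoidal.left_unitality (bigTensor C) (single c)).symm.trans
        (Category.comp_id _).symm
  | n + 2 => by
      change 𝟙 _ ≫ ((tpowStrongator (bigTensor C) (single c) (n + 1)).hom ▷ c) ≫
        (Word.appendIso (tpow (single c) (n + 1)).word (Word.single c)).hom ≫ 𝟙 _ = _
      rw [tpowStrongator_single c (n + 1), Word.appendIso_single_hom, Category.id_comp]
      exact (congrArg _ (Category.comp_id _)).trans <|
        (Word.eqToHom_whiskerRight_snocIso (tpow_single c (n + 1)).symm c).trans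
          (Category.id_comp _)

variable {P : Type u} [Category.{v} P] [MonoidalCategory P] [SymmetricCategory P] [PROP P]
  [SymmetricCategory C] (s : Supply P C)

theorem strictSingle_eq_pullbackMap (c : C) {p q : P} (μ : p ⟶ q) :
    s.strictSingle c μ = s.pullbackMap (bigTensor C) (single c) μ := by
  apply (bigTensor C).map_injective
  rw [Supply.map_pullbackMap, Iso.eq_inv_comp, tpowStrongator_single, tpowStrongator_single,
    Supply.strictSingle, Functor.map_comp, Functor.map_comp, eqToHom_map, eqToHom_map]
  exact (eqToHom_trans_assoc _ _ _).trans (Category.id_comp _)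

/-- The supply in the strictification induced by `s`, obtained by pulling `s` back along `⨂`. -/
noncomputable def supply : Supply P (Strictification C) :=
  s.pullback (bigTensor C) (s.naturalMorphisms.id_mem (𝟙_ C))
    fun X Y => Word.appendIso_hom_mem s.naturalMorphisms X.word Y.word

theorem supply_map (L : Strictification C) {p q : P} (μ : p ⟶ q) :
    (supply s).map L μ = s.pullbackMap (bigTensor C) L μ :=
  s.pullback_map _ _ _ L μ

theorem strictMap_eq_pullbackMap (L : Strictification C) {p q : P} (μ : p ⟶ q) :
    s.strictMap L μ = s.pullbackMap (bigTensor C) L μ := by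
  have strictSingle_eq :
      (fun c => s.strictSingle c μ) = fun c => (supply s).map (single c) μ := by
    funext c
    rw [supply_map, strictSingle_eq_pullbackMap]
  rw [← supply_map, Supply.strictMap, strictSingle_eq,
    reassoc_of% (supply s).tensorMap_sigmaWord, Iso.inv_hom_id_assoc]
  exact ((supply s).map_eqToHom (tensor_single L.word) μ).symm

end Strictification

theorem mainTheorem4
    {P : Type u} [Category.{v} P] [MonoidalCategory P] [SymmetricCategory P] [PROP P]
    {C : Type u₁} [Category.{v₁} C] [MonoidalCategory C] [SymmetricCategory C]
    (s : Supply P C) :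
    (∃ t : Supply P (Strictification C), IsInducedSupply s t) ∧
      ∀ t : Supply P (Strictification C), IsInducedSupply s t →
        PreservesSupply (bigTensor C) t s := by
  refine ⟨⟨Strictification.supply s, fun L p q μ => ?_⟩,
    fun t ht => Supply.preservesSupply_of_map fun L p q μ => ?_⟩
  · rw [Strictification.supply_map, Strictification.strictMap_eq_pullbackMap]
  · rw [ht L μ, Strictification.strictMap_eq_pullbackMap, Supply.tpowStrongator_map_pullbackMap]
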